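/- Let $n$ and $d$ be positive integers and let $\Sigma_d=\{1,\dots,d\}$. A parity game with priorities up to $d$ is a finite directed graph in which every vertex has at least one outgoing edge, every vertex is owned by one of the players Even and Odd, and every edge $e$ has a priority $\pi(e)\in\Sigma_d$ (edges with the same endpoints and different priorities are allowed here, as in all graphs below); the owner of the current vertex chooses the outgoing edge to follow, and Even wins an infinite play if and only if the largest priority that occurs infinitely often is even. Let $\mathrm{EvenCycles}_{n,d}\subseteq\Sigma_d^{\omega}$ (respectively $\mathrm{OddCycles}_{n,d}$) be the set of infinite sequences of edge priorities along infinite paths in directed graphs with at most $n$ vertices and edge priorities in $\Sigma_d$, in which the largest priority on every cycle is even (respectively odd). A safety automaton over $\Sigma_d$ has a finite set of states, an initial state $s_0$, a set of rejecting states, and a total transition relation; it accepts an infinite word if it has a run on this word, starting in $s_0$, in which no rejecting state occurs. It is deterministic if for every state $s$ and letter $a$ there is exactly one state $\delta(s,a)$ to which a transition leads from $s$ on $a$, and it is an $(n,d)$-separator if it accepts every word in $\mathrm{EvenCycles}_{n,d}$ and no word in $\mathrm{OddCycles}_{n,d}$. Given a parity game $G$ with priorities up to $d$ and a deterministic safety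 automaton $\mathcal A$ over $\Sigma_d$, the chained product $G\rhd\mathcal A$ is the safety game whose vertices are the pairs $(v,s)$ of a vertex of $G$ and a state of $\mathcal A$, in which the owner of $(v,s)$ is the owner of $v$, the moves lead from $(v,s)$ to $(u,\delta(s,\pi(e)))$ for the edges $e$ of $G$ from $v$ to $u$, and Even wins a play if and only if it never visits a pair $(v,s)$ with $s$ rejecting. **Proposition.** If $G$ is a parity game with at most $n$ vertices and priorities up to $d$, and $\mathcal A$ is a deterministic safety $(n,d)$-separator, then for every vertex $v$ of $G$, Even has a winning strategy in $G$ from $v$ if and only if she has a winning strategy in the chained-product safety game $G\rhd\mathcal A$ from $(v,s_0)$. -/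

import Mathlib

open Filter

/-- The alphabet `Σ_d = {1, 2, …, d}` of priorities. -/
abbrev Priority (d : ℕ) : Type := Set.Icc (1 : ℕ) d

/-- A directed graph with vertex set `V` whose edges carry priorities from `{1, …, d}`. Edges
with the same endpoints and different priorities are allowed. -/
structure PriorityGraph (d : ℕ) (V : Type*) where
  /-- `Edge v a u`: there is an edge of priority `a` from `v` to `u`. -/
  Edge : V → Priority d → V → Prop

namespace PriorityGraph

variable {d : ℕ} {V : Type*}

/-- There is an infinite path in the graph whose successive edges have the priorities
`w 0, w 1, …`. -/
def Encodes (G : PriorityGraph d V) (w : ℕ → Priority d) : Prop :=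
  ∃ p : ℕ → V, ∀ i, G.Edge (p i) (w i) (p (i + 1))

/-- `p 0, p 1, …, p k = p 0` are the vertices and `w 0, …, w (k - 1)` the priorities of the
successive edges of a cycle (of length `k > 0`) in the graph. -/
def IsCycle (G : PriorityGraph d V) (k : ℕ) (p : ℕ → V) (w : ℕ → Priority d) : Prop :=
  0 < k ∧ p k = p 0 ∧ ∀ i < k, G.Edge (p i) (w i) (p (i + 1))

/-- A graph is even if every cycle is even: the largest edge priority on it is even. -/
def IsEvenGraph (G : PriorityGraph d V) : Prop :=
  ∀ k p w, G.IsCycle k p w → ∃ m, IsGreatest {a : ℕ | ∃ i < k, (w i : ℕ) = a} m ∧ Even m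

/-- A graph is odd if every cycle is odd: the largest edge priority on it is odd. -/
def IsOddGraph (G : PriorityGraph d V) : Prop :=
  ∀ k p w, G.IsCycle k p w → ∃ m, IsGreatest {a : ℕ | ∃ i < k, (w i : ℕ) = a} m ∧ Odd m

end PriorityGraph

/-- The infinite words over `{1, …, d}` in which the biggest number that occurs infinitely
many times is even. -/
def LimsupEven (d : ℕ) : Set (ℕ → Priority d) :=
  {w | ∃ m, IsGreatest {a : ℕ | ∃ᶠ i in atTop, (w i : ℕ) = a} m ∧ Even m}

/-- The infinite words that encode an infinite path in an even graph with at most `n` vertices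
and priorities up to `d`. Up to isomorphism, the vertex set is `Fin m` for some `m ≤ n`; and it
makes no difference whether vertices without outgoing edges are allowed, since every vertex on
an infinite path has an outgoing edge and the other vertices can be deleted. -/
def EvenCycles (n d : ℕ) : Set (ℕ → Priority d) :=
  {w | ∃ m ≤ n, ∃ G : PriorityGraph d (Fin m), G.IsEvenGraph ∧ G.Encodes w}

/-- The infinite words that encode an infinite path in an odd graph with at most `n` vertices
and priorities up to `d`. -/
def OddCycles (n d : ℕ) : Set (ℕ → Priority d) :=
  {w | ∃ m ≤ n, ∃ G : PriorityGraph d (Fin m), G.IsOddGraph ∧ G.Encodes w}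

/-- A (possibly non-deterministic) safety automaton with set of states `Q` over the alphabet
`{1, …, d}`, with a total transition relation. -/
structure SafetyAutomaton (d : ℕ) (Q : Type*) where
  /-- The initial state. -/
  init : Q
  /-- The transition relation. -/
  Trans : Q → Priority d → Q → Prop
  /-- The set of rejecting states. -/
  rejecting : Set Q
  /-- Every state has a transition on every letter. -/
  total : ∀ s a, ∃ s', Trans s a s'

namespace SafetyAutomaton

variable {d : ℕ} {Q : Type*}

/-- The transition relation is a function. -/
def IsDeterministic (A : SafetyAutomaton d Q) : Prop :=
  ∀ s a, ∃! s', A.Trans s a s'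

/-- `r` is an infinite run of the automaton on the word `w`. -/
def IsRun (A : SafetyAutomaton d Q) (w : ℕ → Priority d) (r : ℕ → Q) : Prop :=
  r 0 = A.init ∧ ∀ i, A.Trans (r i) (w i) (r (i + 1))

/-- The language of words that have a run in which no rejecting state ever occurs. -/
def language (A : SafetyAutomaton d Q) : Set (ℕ → Priority d) :=
  {w | ∃ r, A.IsRun w r ∧ ∀ i, r i ∉ A.rejecting}

/-- `A` is an `(n, d)`-separator: its language contains `EvenCycles n d` and is disjoint from
`OddCycles n d`. -/
def IsSeparator (A : SafetyAutomaton d Q) (n : ℕ) : Prop :=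
  EvenCycles n d ⊆ A.language ∧ Disjoint A.language (OddCycles n d)

end SafetyAutomaton

/-- The dynamics of a two-player game on a directed graph: every vertex is owned by one of the
two players (here called Even and Odd) and has an outgoing edge. Edges carry labels from `L`, so
that edges with the same endpoints can be told apart. -/
structure Arena (V L : Type*) where
  /-- The vertices owned by Even; all others are owned by Odd. -/
  ownedByEven : Set V
  /-- The edges: `Move v a u` is the possibility to move from `v` to `u` along an edge labelled
  by `a`. -/
  Move : V → L → V → Prop
  /-- Every vertex has at least one outgoing edge. -/
  total : ∀ v, ∃ a u, Move v a u

namespace Arena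

variable {V L : Type*}

/-- A play from the vertex `v`: an infinite path starting at `v`, given by its vertices `p i`
and the labels `w i` of its edges. -/
def IsPlayFrom (R : Arena V L) (v : V) (p : ℕ → V) (w : ℕ → L) : Prop :=
  p 0 = v ∧ ∀ i, R.Move (p i) (w i) (p (i + 1))

/-- A strategy for Even maps the play so far (the list of the vertices left so far, each with
the label of the edge that was then followed) and the current vertex to the label and the target
of the next edge; whenever Even owns the current vertex, this has to be an outgoing edge. (The
values at vertices of Odd are irrelevant.) -/
def IsStrategy (R : Arena V L) (σ : List (V × L) → V → L × V) : Prop :=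
  ∀ h, ∀ v ∈ R.ownedByEven, R.Move v (σ h v).1 (σ h v).2

/-- In the play given by `p` and `w`, all moves of Even are made according to `σ`. -/
def IsConsistent (R : Arena V L) (σ : List (V × L) → V → L × V) (p : ℕ → V) (w : ℕ → L) :
    Prop :=
  ∀ i, p i ∈ R.ownedByEven →
    (w i, p (i + 1)) = σ ((List.range i).map fun j => (p j, w j)) (p i)

/-- Even has a strategy such that every play from `v` in which she follows it satisfies `W`. -/
def EvenWinsFrom (R : Arena V L) (W : (ℕ → V) → (ℕ → L) → Prop) (v : V) : Prop :=
  ∃ σ, R.IsStrategy σ ∧ ∀ p w, R.IsPlayFrom v p w → R.IsConsistent σ p w → W p w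

end Arena

/-- A parity game on the vertex set `V` with priorities up to `d`. -/
structure ParityGame (d : ℕ) (V : Type*) extends PriorityGraph d V where
  /-- The vertices owned by Even; all others are owned by Odd. -/
  ownedByEven : Set V
  /-- Every vertex has at least one outgoing edge. -/
  total : ∀ v, ∃ a u, Edge v a u

/-- A safety game on the vertex set `V`. Even is the safety player. -/
structure SafetyGame (V L : Type*) extends Arena V L where
  /-- The vertices that the safety player has to avoid. -/
  forbidden : Set V

/-- Even has a winning strategy from `v`: one that ensures that no forbidden vertex is ever
visited, the starting vertex included. -/
def SafetyGame.EvenWins {V L : Type*} (S : SafetyGame V L) (v : V) : Prop :=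
  S.EvenWinsFrom (fun p _ => ∀ i, p i ∉ S.forbidden) v

namespace ParityGame

variable {d : ℕ} {V Q : Type*}

/-- The dynamics of play and the ownership of vertices in a parity game. -/
def arena (G : ParityGame d V) : Arena V (Priority d) where
  ownedByEven := G.ownedByEven
  Move := G.Edge
  total := G.total

/-- Even has a winning strategy from `v` in the parity game: one that ensures that the highest
priority that occurs infinitely many times in the play is even. -/
def EvenWins (G : ParityGame d V) (v : V) : Prop :=
  G.arena.EvenWinsFrom (fun _ w => w ∈ LimsupEven d) v

/-- The chained product of a parity game and a (deterministic) safety automaton: a move along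
an edge of the game feeds the priority of this edge to the automaton, the owner of `(v, s)` is
the owner of `v`, and the vertices with rejecting automaton states are forbidden. -/
def chainedProduct (G : ParityGame d V) (A : SafetyAutomaton d Q) :
    SafetyGame (V × Q) (Priority d) where
  ownedByEven := {x | x.1 ∈ G.ownedByEven}
  Move := fun x a y => G.Edge x.1 a y.1 ∧ A.Trans x.2 a y.2
  total := fun x => by
    obtain ⟨a, u, hu⟩ := G.total x.1
    obtain ⟨s, hs⟩ := A.total x.2 a
    exact ⟨a, (u, s), hu, hs⟩
  forbidden := {x | x.2 ∈ A.rejecting}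

end ParityGame

/-!
The heart of the proof is the positional determinacy of finite parity games
(`exists_isPositionalWin_or`): from every vertex, one of the players has a positional strategy such
that all cycles in the graph of the remaining edges, restricted to a set of vertices that cannot be
left, have the parity that is good for this player. Both directions follow from it. If Even has such
a strategy, all plays that follow it are paths in an even graph with at most `n` vertices; so she wins
the parity game, and the automaton accepts all their priority sequences, so that she also wins the
chained product. If Odd has such a strategy, then the play in which he follows it against an
arbitrary strategy of Even is a path in an odd graph with at most `n` vertices; so this strategy of
Even does not win the parity game, and it does not win the chained product either, since otherwise
the automaton would accept a word from `OddCycles`.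

Positional determinacy is proved by induction on `k` for games in which a play stops as soon as it
takes an edge of priority at least `k`, and a predicate `T` tells who wins then
(`exists_isWinningRegion_union_eq_univ`). For the step from `k` to `k + 1`, let `k` be good for the
player, and let `Y` be a maximal region in which the opponent wins positionally. Stop also at the
edges of priority `k`, and let the player win there if and only if the target is outside `Y`. By the
induction hypothesis, this game splits into a region `W` of the player and a region `W'` of the
opponent. The opponent wins `Y ∪ W'` positionally in the original game, with the old strategy inside
`Y` and the new one elsewhere; so `W' ⊆ Y` by maximality. Hence `W` contains the complement
of `Y`, and the player's strategy on `W` wins the original game, since it continues inside `W`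
after an edge of priority `k`, and a cycle with such an edge has the good maximum `k`.
-/

/-! ### Cycles and infinite paths -/

namespace PriorityGraph

variable {d : ℕ} {V : Type*}

/-- Every cycle whose edge priorities are all less than `k` has a largest priority that
satisfies `g`. -/
def CyclesSatisfy (H : PriorityGraph d V) (g : ℕ → Prop) (k : ℕ) : Prop :=
  ∀ m p w, H.IsCycle m p w → (∀ i < m, (w i : ℕ) < k) →
    ∃ i < m, (∀ j < m, (w j : ℕ) ≤ w i) ∧ g (w i)

/-- Since the graph is finite, the largest priority that occurs infinitely often on an infinite path
is the largest one on some cycle of the path. -/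
theorem CyclesSatisfy.exists_isGreatest_frequently [Finite V] {H : PriorityGraph d V}
    {g : ℕ → Prop} (hH : H.CyclesSatisfy g (d + 1)) {p : ℕ → V} {w : ℕ → Priority d}
    (hpw : ∀ i, H.Edge (p i) (w i) (p (i + 1))) :
    ∃ m, IsGreatest {a : ℕ | ∃ᶠ i in atTop, (w i : ℕ) = a} m ∧ g m := by
  classical
  have hle : ∀ i, (w i : ℕ) ≤ d := fun i => (w i).2.2
  have hne : ∃ a : ℕ, ∃ᶠ i in atTop, (w i : ℕ) = a := by
    by_contra! hcon
    have hall : ∀ᶠ i in atTop, ∀ a ∈ Finset.range (d + 1), (w i : ℕ) ≠ a :=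
      (Finset.eventually_all _).2 fun a _ => hcon a
    obtain ⟨i, hi⟩ := hall.exists
    exact hi (w i) (Finset.mem_range.2 (Nat.lt_succ_of_le (hle i))) rfl
  have hbdd : ∀ a : ℕ, (∃ᶠ i in atTop, (w i : ℕ) = a) → a ≤ d := by
    intro a ha
    obtain ⟨i, hi⟩ := ha.exists
    exact hi ▸ hle i
  obtain ⟨a₀, ha₀⟩ := hne
  set M := Nat.findGreatest (fun a => ∃ᶠ i in atTop, (w i : ℕ) = a) d
  have hMfreq : ∃ᶠ i in atTop, (w i : ℕ) = M :=
    Nat.findGreatest_spec (P := fun a => ∃ᶠ i in atTop, (w i : ℕ) = a) (hbdd a₀ ha₀) ha₀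
  have hMmax : ∀ a : ℕ, (∃ᶠ i in atTop, (w i : ℕ) = a) → a ≤ M := fun a ha =>
    Nat.le_findGreatest (hbdd a ha) ha
  refine ⟨M, ⟨hMfreq, hMmax⟩, ?_⟩
  have hev : ∀ᶠ i in atTop, (w i : ℕ) ≤ M := by
    have hall : ∀ᶠ i in atTop, ∀ a ∈ Finset.Ioc M d, (w i : ℕ) ≠ a :=
      (Finset.eventually_all _).2 fun a ha => not_frequently.1 fun hf =>
        (Finset.mem_Ioc.1 ha).1.not_ge (hMmax a hf)
    filter_upwards [hall] with i hi
    by_contra! hlt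
    exact hi _ (Finset.mem_Ioc.2 ⟨hlt, hle i⟩) rfl
  obtain ⟨N, hN⟩ := eventually_atTop.1 hev
  have hinf : {i : ℕ | N ≤ i ∧ (w i : ℕ) = M}.Infinite :=
    Nat.frequently_atTop_iff_infinite.1 (hMfreq.and_eventually (eventually_ge_atTop N) |>.mono
      fun _ h => ⟨h.2, h.1⟩)
  -- Two of the positions after `N` with priority `M` have the same vertex.
  obtain ⟨i, hi, j, hj, hij, hpij⟩ :=
    hinf.exists_lt_map_eq_of_mapsTo (f := p) (Set.mapsTo_univ _ _) Set.finite_univ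
  obtain ⟨l, hl, hmax, hg⟩ := hH (j - i) (fun l => p (i + l)) (fun l => w (i + l))
    ⟨by omega, by simp only [add_zero]; rw [hpij]; congr 1; omega, fun l _ => hpw (i + l)⟩
    (fun l _ => Nat.lt_succ_of_le (hle _))
  have h1 : (w (i + l) : ℕ) ≤ M := hN _ (by have := hi.1; omega)
  have h2 : M ≤ (w (i + l) : ℕ) := by
    have := hmax 0 (by omega)
    simp only [add_zero, hi.2] at this
    exact this
  rwa [le_antisymm h1 h2] at hg

/-- The graph can be renamed to have a vertex set `Fin m`, as required in `EvenCycles` and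
`OddCycles`. -/
theorem CyclesSatisfy.exists_fin [Finite V] {H : PriorityGraph d V}
    {g : ℕ → Prop} (hH : H.CyclesSatisfy g (d + 1)) {w : ℕ → Priority d} (hw : H.Encodes w) :
    ∃ K : PriorityGraph d (Fin (Nat.card V)),
      (∀ k p w, K.IsCycle k p w → ∃ m, IsGreatest {a : ℕ | ∃ i < k, (w i : ℕ) = a} m ∧ g m) ∧
      K.Encodes w := by
  let e := Finite.equivFin V
  refine ⟨⟨fun x a y => H.Edge (e.symm x) a (e.symm y)⟩, ?_, ?_⟩
  · rintro k p w ⟨hk, hp, hedge⟩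
    obtain ⟨i, hi, hmax, hg⟩ := hH k (fun i => e.symm (p i)) w
      ⟨hk, congrArg e.symm hp, hedge⟩ (fun i _ => Nat.lt_succ_of_le (w i).2.2)
    refine ⟨w i, ⟨⟨i, hi, rfl⟩, ?_⟩, hg⟩
    rintro _ ⟨j, hj, rfl⟩
    exact hmax j hj
  · obtain ⟨p, hp⟩ := hw
    exact ⟨fun i => e (p i), fun i => by simpa using hp i⟩

/-! ### Positional determinacy -/

/-- The edges that leave a vertex in `W` and are compatible with the positional strategy `τ` of the
player who owns the vertices in `O`. -/
def strategyGraph (G : PriorityGraph d V) (O W : Set V) (τ : V → Priority d × V) :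
    PriorityGraph d V where
  Edge v a u := G.Edge v a u ∧ v ∈ W ∧ (v ∈ O → (a, u) = τ v)

/-- The player who owns the vertices in `O` has a positional strategy that wins from all vertices in
`W`, when a play stops as soon as it takes an edge of priority at least `k`. The player wins such a
play if the priority and the target of its last edge satisfy `T`. A play that never stops remains in
`W`, and the largest priority on each of its cycles satisfies `g`. -/
def IsWinningRegion (G : PriorityGraph d V) (O : Set V) (g : ℕ → Prop) (k : ℕ)
    (T : Priority d → V → Prop) (W : Set V) : Prop :=
  ∃ τ : V → Priority d × V,
    (∀ v ∈ W, v ∈ O → G.Edge v (τ v).1 (τ v).2) ∧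
    (∀ v a u, (G.strategyGraph O W τ).Edge v a u →
      ((a : ℕ) < k → u ∈ W) ∧ (k ≤ (a : ℕ) → T a u)) ∧
    (G.strategyGraph O W τ).CyclesSatisfy g k

theorem isWinningRegion_empty [Nonempty V] [Nonempty (Priority d)] (G : PriorityGraph d V)
    (O : Set V) (g : ℕ → Prop) (k : ℕ) (T : Priority d → V → Prop) :
    G.IsWinningRegion O g k T ∅ :=
  ⟨fun _ => (Classical.arbitrary _, Classical.arbitrary _), fun _ h => h.elim,
    fun _ _ _ h => h.2.1.elim, fun _ _ _ h => (h.2.2 0 h.1).2.1.elim⟩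

/-- If all plays stop at their first edge, it is enough to look at the edges of each vertex. -/
theorem isWinningRegion_zero [Nonempty V] [Nonempty (Priority d)] (G : PriorityGraph d V)
    (O : Set V) (g : ℕ → Prop) (T : Priority d → V → Prop) (W : Set V)
    (hO : ∀ v ∈ W, v ∈ O → ∃ a u, G.Edge v a u ∧ T a u)
    (hOc : ∀ v ∈ W, v ∉ O → ∀ a u, G.Edge v a u → T a u) :
    G.IsWinningRegion O g 0 T W := by
  have hex : ∀ v, ∃ x : Priority d × V, v ∈ W → v ∈ O → G.Edge v x.1 x.2 ∧ T x.1 x.2 := by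
    intro v
    by_cases h : v ∈ W ∧ v ∈ O
    · obtain ⟨a, u, hau⟩ := hO v h.1 h.2
      exact ⟨(a, u), fun _ _ => hau⟩
    · exact ⟨Classical.arbitrary _, fun h1 h2 => (h ⟨h1, h2⟩).elim⟩
  choose τ hτ using hex
  refine ⟨τ, fun v hW hv => (hτ v hW hv).1, ?_, ?_⟩
  · rintro v a u ⟨he, hW, hs⟩
    refine ⟨fun h => absurd h (Nat.not_lt_zero _), fun _ => ?_⟩
    by_cases hv : v ∈ O
    · have h := (hτ v hW hv).2
      rwa [← hs hv] at h
    · exact hOc v hW hv a u he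
  · intro m p w hc hlt
    exact absurd (hlt 0 hc.1) (Nat.not_lt_zero _)

/-- A winning region `Y` can be enlarged by a region in which the player wins when also the edges
of priority `k` stop a play, with a win for the player if they lead to `Y`. -/
theorem IsWinningRegion.union {G : PriorityGraph d V} {O : Set V} {g : ℕ → Prop} {k : ℕ}
    {T : Priority d → V → Prop} {Y W : Set V} (hY : G.IsWinningRegion O g (k + 1) T Y)
    (hW : G.IsWinningRegion O g k (fun a u => if (a : ℕ) = k then u ∈ Y else T a u) W) :
    G.IsWinningRegion O g (k + 1) T (Y ∪ W) := by
  classical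
  obtain ⟨τ, hτ, hτs, hτc⟩ := hY
  obtain ⟨ρ, hρ, hρs, hρc⟩ := hW
  let θ : V → Priority d × V := fun v => if v ∈ Y then τ v else ρ v
  have hedgeY : ∀ {v a u}, v ∈ Y → (G.strategyGraph O (Y ∪ W) θ).Edge v a u →
      (G.strategyGraph O Y τ).Edge v a u := fun {v a u} hv h =>
    ⟨h.1, hv, fun hO => by simpa [θ, hv] using h.2.2 hO⟩
  have hedgeW : ∀ {v a u}, v ∉ Y → (G.strategyGraph O (Y ∪ W) θ).Edge v a u →
      (G.strategyGraph O W ρ).Edge v a u := fun {v a u} hv h =>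
    ⟨h.1, h.2.1.resolve_left hv, fun hO => by simpa [θ, hv] using h.2.2 hO⟩
  refine ⟨θ, ?_, ?_, ?_⟩
  · intro v hv hO
    by_cases hvY : v ∈ Y
    · simpa [θ, hvY] using hτ v hvY hO
    · simpa [θ, hvY] using hρ v (hv.resolve_left hvY) hO
  · intro v a u h
    by_cases hvY : v ∈ Y
    · have := hτs v a u (hedgeY hvY h)
      exact ⟨fun ha => Or.inl (this.1 ha), this.2⟩
    · obtain ⟨h1, h2⟩ := hρs v a u (hedgeW hvY h)
      refine ⟨fun ha => ?_, fun ha => ?_⟩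
      · rcases Nat.lt_succ_iff_lt_or_eq.1 ha with ha | ha
        · exact Or.inr (h1 ha)
        · exact Or.inl (by simpa [ha] using h2 ha.ge)
      · simpa [show (a : ℕ) ≠ k by omega] using h2 (by omega)
  · rintro m p w ⟨hm, hp, he⟩ hlt
    by_cases hex : ∃ i < m, p i ∈ Y
    · -- The set `Y` is never left, so that it contains the whole cycle.
      obtain ⟨i, hi, hiY⟩ := hex
      have hstep : ∀ j < m, p j ∈ Y → p (j + 1) ∈ Y := fun j hj hjY =>
        (hτs _ _ _ (hedgeY hjY (he j hj))).1 (hlt j hj)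
      have hfwd : ∀ j, i ≤ j → j ≤ m → p j ∈ Y := by
        intro j hij
        induction j, hij using Nat.le_induction with
        | base => exact fun _ => hiY
        | succ j _ ih => exact fun hj => hstep j hj (ih (by omega))
      have hall : ∀ j, j ≤ m → p j ∈ Y := by
        intro j
        induction j with
        | zero => exact fun _ => hp ▸ hfwd m hi.le le_rfl
        | succ j ih => exact fun hj => hstep j hj (ih (by omega))
      exact hτc m p w ⟨hm, hp, fun j hj => hedgeY (hall j hj.le) (he j hj)⟩ hlt
    · -- An edge of priority `k` would lead to `Y`.
      push Not at hex
      have heW : ∀ j < m, (G.strategyGraph O W ρ).Edge (p j) (w j) (p (j + 1)) :=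
        fun j hj => hedgeW (hex j hj) (he j hj)
      refine hρc m p w ⟨hm, hp, heW⟩ fun j hj => ?_
      refine lt_of_le_of_ne (Nat.lt_succ_iff.1 (hlt j hj)) fun hk => ?_
      have hmem : p (j + 1) ∈ Y := by simpa [hk] using (hρs _ _ _ (heW j hj)).2 hk.ge
      rcases (Nat.succ_le_of_lt hj).lt_or_eq with h | h
      · exact hex (j + 1) h hmem
      · exact hex 0 hm (hp ▸ h ▸ hmem)

/-- If `k` satisfies `g`, edges of priority `k` that lead back to the winning region need not stop
the play. -/
theorem IsWinningRegion.succ {G : PriorityGraph d V} {O : Set V} {g : ℕ → Prop} {k : ℕ}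
    (hk : g k) {T : Priority d → V → Prop} {Z W : Set V} (hZ : Z ⊆ W)
    (hW : G.IsWinningRegion O g k (fun a u => if (a : ℕ) = k then u ∈ Z else T a u) W) :
    G.IsWinningRegion O g (k + 1) T W := by
  obtain ⟨τ, hτ, hτs, hτc⟩ := hW
  refine ⟨τ, hτ, ?_, ?_⟩
  · intro v a u h
    obtain ⟨h1, h2⟩ := hτs v a u h
    refine ⟨fun ha => ?_, fun ha => ?_⟩
    · rcases Nat.lt_succ_iff_lt_or_eq.1 ha with ha | ha
      · exact h1 ha
      · exact hZ (by simpa [ha] using h2 ha.ge)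
    · simpa [show (a : ℕ) ≠ k by omega] using h2 (by omega)
  · intro m p w hc hlt
    by_cases hex : ∃ i < m, (w i : ℕ) = k
    · obtain ⟨i, hi, hik⟩ := hex
      exact ⟨i, hi, fun j hj => by have := hlt j hj; omega, hik ▸ hk⟩
    · push Not at hex
      exact hτc m p w hc fun j hj => by have := hlt j hj; have := hex j hj; omega

/-- The induction step of positional determinacy, for a priority `k` that is good for the player. -/
theorem exists_isWinningRegion_union_eq_univ_succ [Finite V] [Nonempty V] [Nonempty (Priority d)]
    {G : PriorityGraph d V} {O : Set V} {g : ℕ → Prop} {k : ℕ} (hk : g k)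
    (ih : ∀ T : Priority d → V → Prop, ∃ W W' : Set V, G.IsWinningRegion O g k T W ∧
      G.IsWinningRegion Oᶜ (fun a => ¬ g a) k (fun a u => ¬ T a u) W' ∧ W ∪ W' = Set.univ)
    (T : Priority d → V → Prop) :
    ∃ W W' : Set V, G.IsWinningRegion O g (k + 1) T W ∧
      G.IsWinningRegion Oᶜ (fun a => ¬ g a) (k + 1) (fun a u => ¬ T a u) W' ∧
      W ∪ W' = Set.univ := by
  obtain ⟨Y, hY⟩ := (Set.toFinite {Y : Set V |
    G.IsWinningRegion Oᶜ (fun a => ¬ g a) (k + 1) (fun a u => ¬ T a u) Y}).exists_maximal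
    ⟨∅, isWinningRegion_empty ..⟩
  obtain ⟨W, W', hW, hW', hu⟩ := ih fun a u => if (a : ℕ) = k then u ∈ Yᶜ else T a u
  have hW'' : G.IsWinningRegion Oᶜ (fun a => ¬ g a) k
      (fun a u => if (a : ℕ) = k then u ∈ Y else ¬ T a u) W' := by
    convert hW' using 3 with a u
    split_ifs <;> simp
  have hsub : W' ⊆ Y :=
    Set.subset_union_right.trans (hY.2 (hY.1.union hW'') Set.subset_union_left)
  have hYW : Yᶜ ⊆ W := fun v hv =>
    ((Set.ext_iff.1 hu v).2 trivial).resolve_right fun h => hv (hsub h)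
  exact ⟨W, Y, hW.succ hk hYW, hY.1, Set.eq_univ_of_forall fun v =>
    (em (v ∈ Y)).elim Or.inr fun h => Or.inl (hYW h)⟩

/-- Positional determinacy when a play stops as soon as it takes an edge of priority at least `k`.
The freedom in the choice of `T` is what makes the induction on `k` work. -/
theorem exists_isWinningRegion_union_eq_univ [Finite V] [Nonempty V] [Nonempty (Priority d)]
    (G : PriorityGraph d V) (O : Set V) (g : ℕ → Prop) (k : ℕ) (T : Priority d → V → Prop) :
    ∃ W W' : Set V, G.IsWinningRegion O g k T W ∧
      G.IsWinningRegion Oᶜ (fun a => ¬ g a) k (fun a u => ¬ T a u) W' ∧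
      W ∪ W' = Set.univ := by
  induction k generalizing T with
  | zero =>
    let W : Set V := {v | (v ∈ O → ∃ a u, G.Edge v a u ∧ T a u) ∧
      (v ∉ O → ∀ a u, G.Edge v a u → T a u)}
    refine ⟨W, Wᶜ, isWinningRegion_zero _ _ _ _ _ (fun v hv => hv.1) (fun v hv => hv.2),
      isWinningRegion_zero _ _ _ _ _ ?_ ?_, Set.union_compl_self W⟩
    · intro v hv hO
      by_contra! hcon
      exact hv ⟨fun h => absurd h hO, fun _ => hcon⟩
    · intro v hv hO a u he hT
      have hO : v ∈ O := not_not.1 hO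
      exact hv ⟨fun _ => ⟨a, u, he, hT⟩, fun h => absurd hO h⟩
  | succ k ih =>
    by_cases hk : g k
    · exact exists_isWinningRegion_union_eq_univ_succ hk ih T
    · -- Exchange the roles of the players.
      obtain ⟨W, W', hW, hW', hu⟩ := exists_isWinningRegion_union_eq_univ_succ (G := G) (O := Oᶜ)
        (g := fun a => ¬ g a) hk (fun T' => by
          obtain ⟨W, W', hW, hW', hu⟩ := ih fun a u => ¬ T' a u
          exact ⟨W', W, by simpa only [not_not] using hW',
            by simpa only [not_not, compl_compl] using hW, by rwa [Set.union_comm]⟩)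
        fun a u => ¬ T a u
      exact ⟨W', W, by simpa only [not_not, compl_compl] using hW', hW,
        by rwa [Set.union_comm]⟩

/-- The positional strategy `τ` of the player who owns the vertices in `O` keeps every play from `v`
in `W`, and all cycles that it admits there have a largest priority that satisfies `g`. -/
structure IsPositionalWin (G : PriorityGraph d V) (O : Set V) (g : ℕ → Prop) (v : V) (W : Set V)
    (τ : V → Priority d × V) : Prop where
  edge : ∀ u ∈ O, G.Edge u (τ u).1 (τ u).2
  mem : v ∈ W
  closed : ∀ x a y, (G.strategyGraph O W τ).Edge x a y → y ∈ W
  cycles : (G.strategyGraph O W τ).CyclesSatisfy g (d + 1)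

theorem IsWinningRegion.exists_isPositionalWin {G : PriorityGraph d V}
    (htotal : ∀ v, ∃ a u, G.Edge v a u) {O : Set V} {g : ℕ → Prop} {T : Priority d → V → Prop}
    {W : Set V} (hW : G.IsWinningRegion O g (d + 1) T W) {v : V} (hv : v ∈ W) :
    ∃ τ, G.IsPositionalWin O g v W τ := by
  classical
  obtain ⟨τ, hτ, hτs, hτc⟩ := hW
  choose a u hau using htotal
  let θ : V → Priority d × V := fun x => if x ∈ W then τ x else (a x, u x)
  have hθ : G.strategyGraph O W θ = G.strategyGraph O W τ := by
    simp only [strategyGraph, mk.injEq]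
    ext x b y
    exact and_congr_right fun _ => and_congr_right fun hx => by simp only [θ, if_pos hx]
  refine ⟨θ, fun x hO => ?_, hv, fun x b y h => ?_, hθ ▸ hτc⟩
  · by_cases hx : x ∈ W
    · simpa only [θ, if_pos hx] using hτ x hx hO
    · simpa only [θ, if_neg hx] using hau x
  · exact (hτs x b y (hθ ▸ h)).1 (Nat.lt_succ_of_le b.2.2)

/-- Positional determinacy of finite parity games. -/
theorem exists_isPositionalWin_or [Finite V] {G : PriorityGraph d V}
    (htotal : ∀ v, ∃ a u, G.Edge v a u) (O : Set V) (v : V) :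
    (∃ W τ, G.IsPositionalWin O Even v W τ) ∨ ∃ W τ, G.IsPositionalWin Oᶜ Odd v W τ := by
  have : Nonempty V := ⟨v⟩
  have : Nonempty (Priority d) := ⟨(htotal v).choose⟩
  -- Priorities are at most `d`, so that no edge stops a play and the predicate is irrelevant.
  obtain ⟨W, W', hW, hW', hu⟩ :=
    G.exists_isWinningRegion_union_eq_univ O Even (d + 1) fun _ _ => True
  simp only [Nat.not_even_iff_odd] at hW'
  rcases (Set.ext_iff.1 hu v).2 trivial with h | h
  · exact Or.inl ⟨W, hW.exists_isPositionalWin htotal h⟩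
  · exact Or.inr ⟨W', hW'.exists_isPositionalWin htotal h⟩

/-- A path from `v` that follows the strategy never leaves the strategy graph. -/
theorem IsPositionalWin.path {G : PriorityGraph d V} {O : Set V} {g : ℕ → Prop} {v : V}
    {W : Set V} {τ : V → Priority d × V} (h : G.IsPositionalWin O g v W τ) {p : ℕ → V}
    {w : ℕ → Priority d} (h0 : p 0 = v) (he : ∀ i, G.Edge (p i) (w i) (p (i + 1)))
    (hτ : ∀ i, p i ∈ O → (w i, p (i + 1)) = τ (p i)) (i : ℕ) :
    (G.strategyGraph O W τ).Edge (p i) (w i) (p (i + 1)) := by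
  have hmem : p i ∈ W := by
    induction i with
    | zero => exact h0 ▸ h.mem
    | succ i ih => exact h.closed _ _ _ ⟨he i, ih, hτ i⟩
  exact ⟨he i, hmem, hτ i⟩

end PriorityGraph

/-! ### Plays against a positional strategy of Odd -/

/-- If Odd answers a strategy `σ` of Even by a positional strategy `ρ`, there is a play in which
both are followed. -/
theorem Arena.exists_play {V L : Type*} (R : Arena V L) {σ : List (V × L) → V → L × V}
    (hσ : R.IsStrategy σ) {ρ : V → L × V}
    (hρ : ∀ v ∉ R.ownedByEven, R.Move v (ρ v).1 (ρ v).2) (v : V) :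
    ∃ p w, R.IsPlayFrom v p w ∧ R.IsConsistent σ p w ∧
      ∀ i, p i ∉ R.ownedByEven → (w i, p (i + 1)) = ρ (p i) := by
  classical
  let next : List (V × L) × V → L × V := fun x =>
    if x.2 ∈ R.ownedByEven then σ x.1 x.2 else ρ x.2
  -- The history and the current vertex after `i` moves.
  let s : ℕ → List (V × L) × V := fun i =>
    Nat.rec ([], v) (fun _ x => (x.1 ++ [(x.2, (next x).1)], (next x).2)) i
  have hs : ∀ i, s (i + 1) = ((s i).1 ++ [((s i).2, (next (s i)).1)], (next (s i)).2) :=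
    fun _ => rfl
  have hhist : ∀ i, (s i).1 = (List.range i).map fun j => ((s j).2, (next (s j)).1) := by
    intro i
    induction i with
    | zero => rfl
    | succ i ih => rw [hs, List.range_succ, List.map_append, ← ih]; rfl
  refine ⟨fun i => (s i).2, fun i => (next (s i)).1, ⟨rfl, fun i => ?_⟩, fun i hi => ?_,
    fun i hi => ?_⟩
  · simp only [hs]
    by_cases hi : (s i).2 ∈ R.ownedByEven
    · simpa only [next, if_pos hi] using hσ (s i).1 _ hi
    · simpa only [next, if_neg hi] using hρ _ hi
  · rw [← hhist i]
    simp only [hs, next, if_pos hi]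
  · simp only [hs, next, if_neg hi]

/-! ### The parity game and the chained product -/

namespace ParityGame

open PriorityGraph

variable {d : ℕ} {V Q : Type*}

theorem evenWins_of_isPositionalWin [Finite V] {G : ParityGame d V} {v : V} {W : Set V}
    {τ : V → Priority d × V}
    (h : G.toPriorityGraph.IsPositionalWin G.ownedByEven Even v W τ) : G.EvenWins v :=
  ⟨fun _ => τ, fun _ => h.edge, fun _ _ hp hc =>
    h.cycles.exists_isGreatest_frequently (h.path hp.1 hp.2 hc)⟩

theorem not_evenWins_of_isPositionalWin [Finite V] {G : ParityGame d V} {v : V} {W : Set V}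
    {τ : V → Priority d × V}
    (h : G.toPriorityGraph.IsPositionalWin G.ownedByEvenᶜ Odd v W τ) : ¬ G.EvenWins v := by
  rintro ⟨σ, hσ, hwin⟩
  obtain ⟨p, w, hp, hc, hτ⟩ := G.arena.exists_play hσ h.edge v
  obtain ⟨m, hm, heven⟩ := hwin p w hp hc
  obtain ⟨m', hm', hodd⟩ := h.cycles.exists_isGreatest_frequently (h.path hp.1 hp.2 hτ)
  rw [hm.unique hm'] at heven
  exact Nat.not_even_iff_odd.2 hodd heven

theorem chainedProduct_evenWins_of_isPositionalWin [Finite V] {n : ℕ} {G : ParityGame d V}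
    (hV : Nat.card V ≤ n) {A : SafetyAutomaton d Q} (hdet : A.IsDeterministic)
    (hsep : A.IsSeparator n) {v : V} {W : Set V} {τ : V → Priority d × V}
    (h : G.toPriorityGraph.IsPositionalWin G.ownedByEven Even v W τ) :
    (G.chainedProduct A).EvenWins (v, A.init) := by
  choose δ hδ using A.total
  refine ⟨fun _ x => ((τ x.1).1, ((τ x.1).2, δ x.2 (τ x.1).1)),
    fun _ x hx => ⟨h.edge x.1 hx, hδ _ _⟩, fun p w hp hc i hi => ?_⟩
  have hpath := h.path (p := fun i => (p i).1) (w := w) (congrArg Prod.fst hp.1)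
    (fun i => (hp.2 i).1) fun i hi => by
      have hci := hc i hi
      exact Prod.ext (congrArg Prod.fst hci :) (congrArg (fun x => x.2.1) hci :)
  obtain ⟨K, hK, hKw⟩ := h.cycles.exists_fin ⟨_, hpath⟩
  obtain ⟨r, hr, hrej⟩ := hsep.1 ⟨_, hV, K, hK, hKw⟩
  have heq : ∀ i, (p i).2 = r i := by
    intro i
    induction i with
    | zero => rw [hr.1, hp.1]
    | succ i ih => exact (hdet (r i) (w i)).unique (ih ▸ (hp.2 i).2) (hr.2 i)
  exact hrej i (heq i ▸ hi)

theorem not_chainedProduct_evenWins_of_isPositionalWin [Finite V] {n : ℕ} {G : ParityGame d V}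
    (hV : Nat.card V ≤ n) {A : SafetyAutomaton d Q} (hsep : A.IsSeparator n) {v : V}
    {W : Set V} {τ : V → Priority d × V}
    (h : G.toPriorityGraph.IsPositionalWin G.ownedByEvenᶜ Odd v W τ) :
    ¬ (G.chainedProduct A).EvenWins (v, A.init) := by
  rintro ⟨σ, hσ, hwin⟩
  choose δ hδ using A.total
  obtain ⟨p, w, hp, hc, hτ⟩ := (G.chainedProduct A).exists_play hσ
    (ρ := fun x => ((τ x.1).1, ((τ x.1).2, δ x.2 (τ x.1).1)))
    (fun x hx => ⟨h.edge x.1 hx, hδ _ _⟩) (v, A.init)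
  have hpath := h.path (p := fun i => (p i).1) (w := w) (congrArg Prod.fst hp.1)
    (fun i => (hp.2 i).1) fun i hi => by
      have hτi := hτ i hi
      exact Prod.ext (congrArg Prod.fst hτi :) (congrArg (fun x => x.2.1) hτi :)
  obtain ⟨K, hK, hKw⟩ := h.cycles.exists_fin ⟨_, hpath⟩
  have hlang : w ∈ A.language :=
    ⟨fun i => (p i).2, ⟨congrArg Prod.snd hp.1, fun i => (hp.2 i).2⟩, hwin p w hp hc⟩
  exact Set.disjoint_left.1 hsep.2 hlang ⟨_, hV, K, hK, hKw⟩

end ParityGame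

theorem mainTheorem6 {V Q : Type*} [Finite V] [Finite Q] (n d : ℕ)
    (G : ParityGame d V) (hV : Nat.card V ≤ n)
    (A : SafetyAutomaton d Q) (hdet : A.IsDeterministic) (hsep : A.IsSeparator n) (v : V) :
    G.EvenWins v ↔ (G.chainedProduct A).EvenWins (v, A.init) := by
  rcases PriorityGraph.exists_isPositionalWin_or G.total G.ownedByEven v with
    ⟨W, τ, h⟩ | ⟨W, τ, h⟩
  · exact iff_of_true (ParityGame.evenWins_of_isPositionalWin h)
      (ParityGame.chainedProduct_evenWins_of_isPositionalWin hV hdet hsep h)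
  · exact iff_of_false (ParityGame.not_evenWins_of_isPositionalWin h)
      (ParityGame.not_chainedProduct_evenWins_of_isPositionalWin hV hsep h)
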